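/- Let $n \geq 3$ and $1 \leq k < n$. For a partition $\lambda$ of $m$ let $\dim(\lambda)$ be the number of paths in the Young lattice from the empty partition to $\lambda$, each step adding one box (that is, the number of standard Young tableaux of shape $\lambda$, which is the dimension of the irreducible representation of $S_m$ indexed by $\lambda$), and let $\pi_m(\lambda)=\dim(\lambda)^2/m!$ be the Plancherel measure on partitions of $m$; put $\pi=\pi_n$. Write $\lambda \nearrow \Lambda$ if $\Lambda$ is obtained from $\lambda$ by adding one box. One step up in the Young lattice moves from a partition $\lambda$ of $m$ to a partition $\Lambda$ of $m+1$ with $\lambda\nearrow\Lambda$ with probability $\frac{\dim(\lambda)\,\pi_{m+1}(\Lambda)}{\dim(\Lambda)\,\pi_m(\lambda)}$; one step down moves from a partition $\Lambda$ of $m+1$ to a partition $\mu$ of $m$ with $\mu\nearrow\Lambda$ with probability $\frac{\dim(\mu)}{\dim(\Lambda)}$. Let $J(k)$ be the Markov chain on the partitions of $n$ that in each move first takes $k$ successive steps down and then $k$ successive steps up. Let $(n)$ be the partition with one part of size $n$, let $J(k)^r((n),\lambda)=J(k)^r_{(n)}(\lambda)$ be the probability that the chain started at $(n)$ is at $\lambda$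 after $r$ moves, and let $\|J(k)^r_{(n)}-\pi\|_{TV}=\frac12\sum_{|\lambda|=n}|J(k)^r((n),\lambda)-\pi(\lambda)|$. Put $\beta=\frac{(n-k)(n-k-1)}{n(n-1)}$. Then for every integer $r \geq 0$, \[ 2\,\|J(k)^r_{(n)}-\pi\|_{TV} \;\leq\; \Bigl(\sum_{|\lambda|=n}\Bigl|\frac{J(k)^r((n),\lambda)}{\pi(\lambda)}-1\Bigr|^2\pi(\lambda)\Bigr)^{1/2} \;\leq\; \sqrt{n!}\;\beta^r \] (with $\beta^0=1$). Moreover, for every real $c$ and every integer $r\ge 0$ with $r > \frac{n\log n+2c}{2\log(1/\beta)}$, \[ \|J(k)^r_{(n)}-\pi\|_{TV} \;\leq\; \frac{(2\pi)^{1/4}}{2}\,e^{-c}, \] where the $\pi$ on the right is the number $\pi$, and where for $k=n-1$, when $\beta=0$, the condition on $r$ is read as $r>0$. -/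

import Mathlib

namespace YoungChain

/-- The partitions of `n`, as Young diagrams with `n` boxes: level `n` of the Young lattice. -/
abbrev Level (n : ℕ) : Type := {lam : YoungDiagram // lam.card = n}

/-- Every box of a Young diagram with `n` boxes has both coordinates smaller than `n`. -/
theorem cells_subset {n : ℕ} (lam : Level n) :
    lam.1.cells ⊆ Finset.range n ×ˢ Finset.range n := by
  rintro ⟨i, j⟩ h
  have hmem : (i, j) ∈ lam.1 := h
  have hrow : ∀ j' ≤ j, (i, j') ∈ lam.1 := fun j' hj => lam.1.up_left_mem le_rfl hj hmem
  have hcol : ∀ i' ≤ i, (i', j) ∈ lam.1 := fun i' hi => lam.1.up_left_mem hi le_rfl hmem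
  have h1 : (Finset.range (j + 1)).card ≤ lam.1.cells.card :=
    Finset.card_le_card_of_injOn (fun j' => (i, j'))
      (fun j' hj => hrow j' (by simpa [Nat.lt_succ_iff] using hj))
      (fun a _ b _ hab => by simpa using hab)
  have h2 : (Finset.range (i + 1)).card ≤ lam.1.cells.card :=
    Finset.card_le_card_of_injOn (fun i' => (i', j))
      (fun i' hi => hcol i' (by simpa [Nat.lt_succ_iff] using hi))
      (fun a _ b _ hab => by simpa using hab)
  have hc : lam.1.cells.card = n := lam.2
  simp only [Finset.card_range] at h1 h2
  simp only [Finset.mem_product, Finset.mem_range]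
  omega

instance finite_level (n : ℕ) : Finite (Level n) := by
  refine Finite.of_injective
    (fun lam : Level n =>
      (⟨lam.1.cells, Finset.mem_powerset.2 (cells_subset lam)⟩ :
        {s // s ∈ (Finset.range n ×ˢ Finset.range n).powerset})) ?_
  intro a b h
  exact Subtype.ext (YoungDiagram.ext (by simpa using h))

noncomputable instance fintypeLevel (n : ℕ) : Fintype (Level n) := Fintype.ofFinite _

noncomputable instance decidableEqLevel (n : ℕ) : DecidableEq (Level n) := Classical.decEq _

/-- `Lam` is obtained from `mu` by adding one box: the edges of the Young lattice. -/
def AddBox (mu Lam : YoungDiagram) : Prop := mu ≤ Lam ∧ Lam.card = mu.card + 1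

open Classical in
/-- The multiplicity function of the Young lattice: `1` on every edge, `0` on non-edges. -/
noncomputable def kappa (mu Lam : YoungDiagram) : ℕ := if AddBox mu Lam then 1 else 0

/-- `dim n lam` is the number of paths `∅ ↗ ⋯ ↗ lam` in the Young lattice from the empty diagram
to the diagram `lam` with `n` boxes (equivalently, of standard Young tableaux of shape `lam`),
counted according to the last step of the path. -/
noncomputable def dim : (n : ℕ) → Level n → ℕ
  | 0, _ => 1
  | n + 1, Lam => ∑ mu : Level n, kappa mu.1 Lam.1 * dim n mu

/-- The Plancherel measure on the partitions of `n`. -/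
noncomputable def plancherel (n : ℕ) (lam : Level n) : ℝ :=
  (dim n lam : ℝ) ^ 2 / (n.factorial : ℝ)

/-- Transition probabilities of one step up in the Young lattice. It is used for `m = n + 1`;
otherwise there are no edges from level `n` to level `m` and all entries vanish. -/
noncomputable def up (n m : ℕ) : Matrix (Level n) (Level m) ℝ := fun lam Lam =>
  (dim n lam : ℝ) * plancherel m Lam * (kappa lam.1 Lam.1 : ℝ) /
    ((dim m Lam : ℝ) * plancherel n lam)

/-- Transition probabilities of one step down in the Young lattice. It is used for `m = n + 1`;
otherwise there are no edges from level `n` to level `m` and all entries vanish. -/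
noncomputable def down (m n : ℕ) : Matrix (Level m) (Level n) ℝ := fun Lam mu =>
  (dim n mu : ℝ) * (kappa mu.1 Lam.1 : ℝ) / (dim m Lam : ℝ)

/-- `k` successive steps down, from level `n` to level `n - k` (meant for `k ≤ n`). -/
noncomputable def downSteps (n : ℕ) : (k : ℕ) → Matrix (Level n) (Level (n - k)) ℝ
  | 0 => (1 : Matrix (Level n) (Level n) ℝ)
  | k + 1 => downSteps n k * down (n - k) (n - (k + 1))

/-- `k` successive steps up, from level `n - k` to level `n` (meant for `k ≤ n`). -/
noncomputable def upSteps (n : ℕ) : (k : ℕ) → Matrix (Level (n - k)) (Level n) ℝ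
  | 0 => (1 : Matrix (Level n) (Level n) ℝ)
  | k + 1 => up (n - (k + 1)) (n - k) * upSteps n k

/-- The transition matrix of the Markov chain `J(k)` on the partitions of `n`: first `k` steps
down, then `k` steps up. -/
noncomputable def J (n k : ℕ) : Matrix (Level n) (Level n) ℝ := downSteps n k * upSteps n k

/-- The one-row partition `(n)`. -/
def oneRow (n : ℕ) : Level n :=
  ⟨{ cells := {0} ×ˢ Finset.range n
     isLowerSet := by
       rintro ⟨a, b⟩ ⟨c, d⟩ h hab
       have h1 : c ≤ a := h.1
       have h2 : d ≤ b := h.2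
       simp only [Finset.coe_product, Set.mem_prod, Finset.coe_singleton, Set.mem_singleton_iff,
         Finset.coe_range, Set.mem_Iio] at hab ⊢
       omega }, by simp [YoungDiagram.card]⟩

/-- Total variation distance of two measures on a finite set, given by their point masses. -/
noncomputable def tvDist {X : Type*} [Fintype X] (p q : X → ℝ) : ℝ :=
  1 / 2 * ∑ y, |p y - q y|

/-- The norm of `ℓ²(π)` for a measure `π` on a finite set, given by its point masses. -/
noncomputable def ell2Norm {X : Type*} [Fintype X] (π f : X → ℝ) : ℝ :=
  (∑ x, |f x| ^ 2 * π x) ^ (1 / 2 : ℝ)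

end YoungChain

namespace YoungChain

/-! Divide a signed measure on level `m` by `dim`. A down step then becomes the down operator `D` of
the Young lattice (`edge` as a matrix), and the up step from level `m` becomes `U / (m + 1)` with
`U` its transpose (`dens_vecMul_down`, `dens_vecMul_up`). Everything rests on `DU = UD + 1`
(`sum_kappa_mul_kappa`): a diagram has one more addable row than removable rows, and two different
diagrams of equal size have a common upper neighbour exactly when they have a common lower one.

This relation makes `dim` an eigenvector of `DU`, which gives `∑ dim² = m!` and the stationarity of
the Plancherel measure. Total mass zero means that the density is orthogonal to `dim`. There `‖Uw‖²
= ‖w‖² + ‖Dw‖²` and the adjointness of `D` and `U` give, by induction, `‖Dg‖² ≤ (m - 2)‖g‖²` on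
level `m` (`edge_mulVec_le`). The induction starts at level 1, which has a single diagram and hence
no nonzero density of mass zero.

Multiplied over `k` steps down and `k` steps up, these bounds telescope: one move contracts the norm
by `β`. Finally `√n!` times the norm of the density of `p - π` is the `ℓ²(π)` norm, and a point mass
minus `π` has density of norm at most 1. -/

/-! ### Adding and removing boxes -/

theorem AddBox.exists_cell {mu Lam : YoungDiagram} (h : AddBox mu Lam) :
    ∃ c ∉ mu, Lam.cells = insert c mu.cells := by
  obtain ⟨c, hc⟩ := Finset.card_eq_one.1
    (show (Lam.cells \ mu.cells).card = 1 by
      have h1 := Finset.card_sdiff_add_card_eq_card (YoungDiagram.cells_subset_iff.2 h.1)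
      have h2 : Lam.cells.card = mu.cells.card + 1 := h.2
      omega)
  have hm : c ∈ Lam.cells \ mu.cells := by simp [hc]
  refine ⟨c, (Finset.mem_sdiff.1 hm).2, ?_⟩
  rw [← Finset.sdiff_union_of_subset (YoungDiagram.cells_subset_iff.2 h.1), hc,
    Finset.singleton_union]

theorem addBox_of_cells {mu Lam : YoungDiagram} {c : ℕ × ℕ} (hc : c ∉ mu)
    (h : Lam.cells = insert c mu.cells) : AddBox mu Lam := by
  refine ⟨YoungDiagram.cells_subset_iff.1 (h ▸ Finset.subset_insert _ _), ?_⟩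
  change Lam.cells.card = mu.cells.card + 1
  rw [h, Finset.card_insert_of_notMem (by simpa using hc)]

/-- The rows of `lam` from which a box can be removed. -/
def removableRows (lam : YoungDiagram) : Finset ℕ :=
  (Finset.range lam.card).filter fun i => lam.rowLen (i + 1) < lam.rowLen i

/-- The cut-off at `lam.card` loses nothing: a row longer than the next one is nonempty, and its
first box bounds its index. -/
theorem mem_removableRows {lam : YoungDiagram} {i : ℕ} :
    i ∈ removableRows lam ↔ lam.rowLen (i + 1) < lam.rowLen i := by
  simp only [removableRows, Finset.mem_filter, Finset.mem_range, and_iff_right_iff_imp]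
  intro h
  have hm : (i, 0) ∈ lam.cells := by
    rw [YoungDiagram.mem_cells, YoungDiagram.mem_iff_lt_rowLen]; omega
  have := cells_subset (⟨lam, rfl⟩ : Level lam.card) hm
  simp only [Finset.mem_product, Finset.mem_range] at this
  exact this.1

/-- The rows of `lam` to which a box can be added. -/
def addableRows (lam : YoungDiagram) : Finset ℕ :=
  insert 0 ((removableRows lam).image Nat.succ)

theorem mem_addableRows {lam : YoungDiagram} {i : ℕ} :
    i ∈ addableRows lam ↔ ∀ j, i = j + 1 → lam.rowLen i < lam.rowLen j := by
  cases i <;> simp [addableRows, mem_removableRows]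

/-- Row 0 always accepts a box, and row `i + 1` accepts one exactly when row `i` can lose one. This
surplus of one is the identity term in `DU = UD + 1`. -/
theorem card_addableRows (lam : YoungDiagram) :
    (addableRows lam).card = (removableRows lam).card + 1 := by
  rw [addableRows, Finset.card_insert_of_notMem (by simp),
    Finset.card_image_of_injective _ Nat.succ_injective]

/-- Add a box at the end of an addable row. -/
def addAt (lam : YoungDiagram) (i : ℕ) (hi : i ∈ addableRows lam) : YoungDiagram where
  cells := insert (i, lam.rowLen i) lam.cells
  isLowerSet := by
    rintro ⟨a, b⟩ ⟨c, d⟩ hle h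
    obtain ⟨h1, h2⟩ : c ≤ a ∧ d ≤ b := hle
    simp only [Finset.coe_insert, Set.mem_insert_iff, Prod.mk.injEq, Finset.mem_coe,
      YoungDiagram.mem_cells] at h ⊢
    rcases h with ⟨rfl, rfl⟩ | h
    · rw [YoungDiagram.mem_iff_lt_rowLen]
      rcases h1.lt_or_eq with h1 | rfl
      · right
        obtain ⟨j, rfl⟩ : ∃ j, a = j + 1 := ⟨a - 1, by omega⟩
        have := mem_addableRows.1 hi j rfl
        have := lam.rowLen_anti c j (by omega)
        omega
      · omega
    · exact Or.inr (lam.up_left_mem h1 h2 h)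

/-- Remove the last box of a removable row. -/
def removeAt (lam : YoungDiagram) (i : ℕ) (hi : i ∈ removableRows lam) : YoungDiagram where
  cells := lam.cells.erase (i, lam.rowLen i - 1)
  isLowerSet := by
    rintro ⟨a, b⟩ ⟨c, d⟩ hle h
    obtain ⟨h1, h2⟩ : c ≤ a ∧ d ≤ b := hle
    simp only [Finset.coe_erase, Set.mem_sdiff, Set.mem_singleton_iff, Prod.mk.injEq,
      Finset.mem_coe, YoungDiagram.mem_cells] at h ⊢
    refine ⟨lam.up_left_mem h1 h2 h.1, ?_⟩
    rintro ⟨rfl, rfl⟩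
    rw [YoungDiagram.mem_iff_lt_rowLen] at h
    have hi' := mem_removableRows.1 hi
    rcases h1.lt_or_eq with h1 | rfl
    · have := lam.rowLen_anti (c + 1) a (by omega)
      omega
    · omega

theorem addBox_addAt (lam : YoungDiagram) (i : ℕ) (hi : i ∈ addableRows lam) :
    AddBox lam (addAt lam i hi) :=
  addBox_of_cells (c := (i, lam.rowLen i)) (by simp [YoungDiagram.mem_iff_lt_rowLen]) rfl

theorem addBox_removeAt (lam : YoungDiagram) (i : ℕ) (hi : i ∈ removableRows lam) :
    AddBox (removeAt lam i hi) lam := by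
  have hi' := mem_removableRows.1 hi
  refine addBox_of_cells (c := (i, lam.rowLen i - 1)) ?_ ?_
  · rw [← YoungDiagram.mem_cells]
    simp [removeAt]
  · simp only [removeAt]
    rw [Finset.insert_erase]
    rw [YoungDiagram.mem_cells, YoungDiagram.mem_iff_lt_rowLen]
    omega

theorem AddBox.eq_addAt {lam Lam : YoungDiagram} (h : AddBox lam Lam) :
    ∃ i, ∃ hi : i ∈ addableRows lam, addAt lam i hi = Lam := by
  obtain ⟨⟨i, j⟩, hc, hL⟩ := h.exists_cell
  have hmem : ∀ c, c ∈ Lam ↔ c = (i, j) ∨ c ∈ lam := fun c => by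
    rw [← YoungDiagram.mem_cells, hL]; simp
  have hij : (i, j) ∈ Lam := (hmem _).2 (Or.inl rfl)
  rw [YoungDiagram.mem_iff_lt_rowLen] at hc
  have hj : j = lam.rowLen i := by
    by_contra hne
    have h1 := (hmem (i, lam.rowLen i)).1 (Lam.up_left_mem le_rfl (by omega) hij)
    simp only [Prod.mk.injEq, true_and, YoungDiagram.mem_iff_lt_rowLen] at h1
    omega
  subst hj
  refine ⟨i, mem_addableRows.2 ?_, YoungDiagram.ext hL.symm⟩
  rintro a rfl
  have h1 := (hmem (a, lam.rowLen (a + 1))).1 (Lam.up_left_mem (by omega) le_rfl hij)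
  simp only [Prod.mk.injEq, YoungDiagram.mem_iff_lt_rowLen] at h1
  omega

theorem AddBox.eq_removeAt {nu lam : YoungDiagram} (h : AddBox nu lam) :
    ∃ i, ∃ hi : i ∈ removableRows lam, removeAt lam i hi = nu := by
  obtain ⟨⟨i, j⟩, hc, hL⟩ := h.exists_cell
  have hmem : ∀ c, c ∈ lam ↔ c = (i, j) ∨ c ∈ nu := fun c => by
    rw [← YoungDiagram.mem_cells, hL]; simp
  have hij : (i, j) ∈ lam := (hmem _).2 (Or.inl rfl)
  have hj : j + 1 = lam.rowLen i := by
    rw [YoungDiagram.mem_iff_lt_rowLen] at hij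
    by_contra hne
    have h1 := (hmem (i, j + 1)).1 (by rw [YoungDiagram.mem_iff_lt_rowLen]; omega)
    simp only [Prod.mk.injEq, true_and, Nat.succ_ne_self, false_or] at h1
    exact hc (nu.up_left_mem le_rfl (by omega) h1)
  refine ⟨i, mem_removableRows.2 ?_, YoungDiagram.ext ?_⟩
  · by_contra hne
    have h1 := (hmem (i + 1, j)).1 (by rw [YoungDiagram.mem_iff_lt_rowLen]; omega)
    simp only [Prod.mk.injEq, Nat.succ_ne_self, false_and, false_or] at h1
    exact hc (nu.up_left_mem (by omega) le_rfl h1)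
  · simp only [removeAt, hL, ← hj, Nat.add_sub_cancel]
    exact Finset.erase_insert (by simpa using hc)

open Classical in
theorem card_covers {n : ℕ} (lam : Level n) :
    (Finset.univ.filter fun Lam : Level (n + 1) => AddBox lam.1 Lam.1).card =
      (addableRows lam.1).card := by
  symm
  refine Finset.card_bij
    (fun i hi => ⟨addAt lam.1 i hi, (addBox_addAt lam.1 i hi).2.trans (by rw [lam.2])⟩) ?_ ?_ ?_
  · intro i hi
    simpa using addBox_addAt lam.1 i hi
  · intro i hi j hj h
    have h1 : (i, lam.1.rowLen i) ∈ (addAt lam.1 i hi).cells := Finset.mem_insert_self _ _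
    rw [Subtype.mk.injEq] at h
    rw [h] at h1
    simp only [addAt, Finset.mem_insert, Prod.mk.injEq, YoungDiagram.mem_cells,
      YoungDiagram.mem_iff_lt_rowLen, lt_self_iff_false, or_false] at h1
    exact h1.1
  · intro Lam h
    obtain ⟨i, hi, h⟩ := (Finset.mem_filter.1 h).2.eq_addAt
    exact ⟨i, hi, Subtype.ext h⟩

open Classical in
theorem card_coveredBy {n : ℕ} (lam : Level (n + 1)) :
    (Finset.univ.filter fun nu : Level n => AddBox nu.1 lam.1).card =
      (removableRows lam.1).card := by
  symm
  refine Finset.card_bij (fun i hi => ⟨removeAt lam.1 i hi, by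
    have := (addBox_removeAt lam.1 i hi).2
    have := lam.2
    omega⟩) ?_ ?_ ?_
  · intro i hi
    simpa using addBox_removeAt lam.1 i hi
  · intro i hi j hj h
    have h1 : (i, lam.1.rowLen i - 1) ∉ (removeAt lam.1 i hi).cells := Finset.notMem_erase _ _
    rw [Subtype.mk.injEq] at h
    rw [h] at h1
    have := mem_removableRows.1 hi
    simp only [removeAt, Finset.mem_erase, ne_eq, Prod.mk.injEq, YoungDiagram.mem_cells,
      YoungDiagram.mem_iff_lt_rowLen] at h1
    by_contra hne
    exact h1 ⟨fun h => hne h.1, by omega⟩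
  · intro Lam h
    obtain ⟨i, hi, h⟩ := (Finset.mem_filter.1 h).2.eq_removeAt
    exact ⟨i, hi, Subtype.ext h⟩

/-! ### The commutation relation `DU = UD + 1` -/

theorem card_sup_add_card_inf (lam mu : YoungDiagram) :
    (lam ⊔ mu).card + (lam ⊓ mu).card = lam.card + mu.card :=
  Finset.card_union_add_card_inter lam.cells mu.cells

theorem eq_of_le_of_card_le {lam mu : YoungDiagram} (h : lam ≤ mu) (hc : mu.card ≤ lam.card) :
    lam = mu :=
  YoungDiagram.ext (Finset.eq_of_subset_of_card_le (YoungDiagram.cells_subset_iff.2 h) hc)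

theorem card_lt_card_sup {n : ℕ} {lam mu : Level n} (h : lam ≠ mu) :
    n < (lam.1 ⊔ mu.1).card := by
  by_contra! hc
  apply h
  have h1 := eq_of_le_of_card_le (le_sup_left : lam.1 ≤ lam.1 ⊔ mu.1) (by rw [lam.2]; exact hc)
  have h2 := eq_of_le_of_card_le (le_sup_right : mu.1 ≤ lam.1 ⊔ mu.1) (by rw [mu.2]; exact hc)
  exact Subtype.ext (h1.trans h2.symm)

/-- A common upper neighbour contains the union, which already has more than `n` boxes when the
diagrams differ. -/
theorem addBox_both_iff_sup {n : ℕ} {lam mu : Level n} (h : lam ≠ mu) (Lam : Level (n + 1)) :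
    AddBox lam.1 Lam.1 ∧ AddBox mu.1 Lam.1 ↔ Lam.1 = lam.1 ⊔ mu.1 := by
  have hlt := card_lt_card_sup h
  constructor
  · rintro ⟨h1, h2⟩
    exact (eq_of_le_of_card_le (sup_le h1.1 h2.1) (by rw [Lam.2]; omega)).symm
  · intro hL
    have := Lam.2
    have := lam.2
    have := mu.2
    exact ⟨⟨hL ▸ le_sup_left, by omega⟩, ⟨hL ▸ le_sup_right, by omega⟩⟩

theorem addBox_both_iff_inf {n : ℕ} {lam mu : Level (n + 1)} (h : lam ≠ mu) (nu : Level n) :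
    AddBox nu.1 lam.1 ∧ AddBox nu.1 mu.1 ↔ nu.1 = lam.1 ⊓ mu.1 := by
  have hlt := card_lt_card_sup h
  have hs := card_sup_add_card_inf lam.1 mu.1
  have := lam.2
  have := mu.2
  have := nu.2
  constructor
  · rintro ⟨h1, h2⟩
    exact eq_of_le_of_card_le (le_inf h1.1 h2.1) (by omega)
  · intro hL
    exact ⟨⟨hL ▸ inf_le_left, by omega⟩, ⟨hL ▸ inf_le_right, by omega⟩⟩

theorem kappa_mul_kappa_self (mu Lam : YoungDiagram) :
    kappa mu Lam * kappa mu Lam = kappa mu Lam := by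
  unfold kappa; split_ifs <;> rfl

/-- The up and down operators of the Young lattice satisfy `DU = UD + 1`. -/
theorem sum_kappa_mul_kappa {n : ℕ} (lam mu : Level (n + 1)) :
    ∑ Lam : Level (n + 2), kappa lam.1 Lam.1 * kappa mu.1 Lam.1 =
      ∑ nu : Level n, kappa nu.1 lam.1 * kappa nu.1 mu.1 + if lam = mu then 1 else 0 := by
  classical
  by_cases h : lam = mu
  · subst h
    simp only [kappa_mul_kappa_self]
    simp only [kappa, Finset.sum_boole, Nat.cast_id, if_true]
    rw [card_covers, card_coveredBy, card_addableRows]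
  · have h1 : ∀ Lam : Level (n + 2), kappa lam.1 Lam.1 * kappa mu.1 Lam.1 =
        if Lam.1 = lam.1 ⊔ mu.1 then 1 else 0 := fun Lam => by
      simp only [kappa, ← addBox_both_iff_sup h, ite_and]
      split_ifs <;> rfl
    have h2 : ∀ nu : Level n, kappa nu.1 lam.1 * kappa nu.1 mu.1 =
        if nu.1 = lam.1 ⊓ mu.1 then 1 else 0 := fun nu => by
      simp only [kappa, ← addBox_both_iff_inf h, ite_and]
      split_ifs <;> rfl
    have hs := card_sup_add_card_inf lam.1 mu.1
    have e1 := lam.2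
    have e2 := mu.2
    simp only [h1, h2, h, if_false, add_zero]
    -- Union and intersection have `2 (n + 1)` boxes together, so the union lies on level `n + 2`
    -- exactly when the intersection lies on level `n`; both sums are then 1, and otherwise both are
    -- 0.
    by_cases hc : (lam.1 ⊔ mu.1).card = n + 2
    · have hc' : (lam.1 ⊓ mu.1).card = n := by omega
      rw [Fintype.sum_eq_single (⟨lam.1 ⊔ mu.1, hc⟩ : Level (n + 2))
          (fun x hx => if_neg fun e => hx (Subtype.ext e)),
        Fintype.sum_eq_single (⟨lam.1 ⊓ mu.1, hc'⟩ : Level n)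
          (fun x hx => if_neg fun e => hx (Subtype.ext e))]
      simp
    · rw [Finset.sum_eq_zero, Finset.sum_eq_zero]
      · intro nu _
        refine if_neg fun e => hc ?_
        have := nu.2
        rw [e] at this
        omega
      · intro Lam _
        refine if_neg fun e => hc ?_
        have := Lam.2
        rwa [e] at this

theorem sum_kappa_mul_kappa_zero (lam mu : Level 0) :
    ∑ Lam : Level 1, kappa lam.1 Lam.1 * kappa mu.1 Lam.1 = 1 := by
  classical
  have h0 : ∀ nu : Level 0, nu.1.cells = ∅ := fun nu => Finset.card_eq_zero.1 nu.2
  have h : lam = mu := Subtype.ext (YoungDiagram.ext ((h0 _).trans (h0 _).symm))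
  subst h
  simp only [kappa_mul_kappa_self]
  simp only [kappa, Finset.sum_boole, Nat.cast_id]
  rw [card_covers, card_addableRows]
  have h1 := lam.2
  simp [removableRows, h1]

theorem dim_pos : ∀ (n : ℕ) (lam : Level n), 0 < dim n lam
  | 0, _ => Nat.one_pos
  | n + 1, lam => by
    classical
    obtain ⟨⟨i, j⟩, hc⟩ : lam.1.cells.Nonempty := by
      rw [← Finset.card_pos]
      exact (Nat.succ_pos n).trans_eq lam.2.symm
    rw [YoungDiagram.mem_cells, YoungDiagram.mem_iff_lt_rowLen] at hc
    have hlast : lam.1.rowLen (n + 1) = 0 := by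
      by_contra h
      have hm : (n + 1, 0) ∈ lam.1.cells := by
        rw [YoungDiagram.mem_cells, YoungDiagram.mem_iff_lt_rowLen]; omega
      simpa using cells_subset lam hm
    -- Without a removable row the row lengths, which never increase, would never decrease either.
    -- They would be constant, although row `i` is nonempty and row `n + 1` is empty.
    obtain ⟨i, hi⟩ : (removableRows lam.1).Nonempty := by
      by_contra hne
      rw [Finset.not_nonempty_iff_eq_empty] at hne
      have hmono : Monotone lam.1.rowLen := monotone_nat_of_le_succ fun a => by
        by_contra! hlt
        simpa [hne] using mem_removableRows.2 hlt
      rcases le_total i (n + 1) with h | h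
      · have := hmono h
        omega
      · have := lam.1.rowLen_anti _ _ h
        omega
    have hb := addBox_removeAt lam.1 i hi
    rw [dim]
    refine Finset.sum_pos' (fun _ _ => Nat.zero_le _)
      ⟨⟨removeAt lam.1 i hi, by have := hb.2; have := lam.2; omega⟩, Finset.mem_univ _, ?_⟩
    simp [kappa, hb, dim_pos n]

instance subsingleton_level_one : Subsingleton (Level 1) := by
  have h : ∀ lam : Level 1, lam.1.cells = {(0, 0)} := fun lam => by
    refine Finset.eq_of_subset_of_card_le (by simpa using cells_subset lam) ?_
    exact (Finset.card_singleton _).trans_le lam.2.symm.le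
  exact ⟨fun a b => Subtype.ext (YoungDiagram.ext ((h a).trans (h b).symm))⟩

/-! ### Up and down operators as matrices -/

open Matrix

/-- The matrix of the multiplicity function between the levels `n` and `n + 1`. -/
noncomputable def edge (n : ℕ) : Matrix (Level n) (Level (n + 1)) ℝ :=
  of fun lam Lam => (kappa lam.1 Lam.1 : ℝ)

/-- The dimension function as a real vector. -/
noncomputable def dimVec (n : ℕ) : Level n → ℝ := fun lam => dim n lam

theorem dimVec_pos {n : ℕ} (lam : Level n) : 0 < dimVec n lam :=
  Nat.cast_pos.2 (dim_pos n lam)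

theorem dimVec_ne_zero {n : ℕ} (lam : Level n) : dimVec n lam ≠ 0 := (dimVec_pos lam).ne'

theorem edge_mul_transpose_zero : edge 0 * (edge 0)ᵀ = 1 := by
  ext lam mu
  have h : lam = mu := Subtype.ext (YoungDiagram.ext
    ((Finset.card_eq_zero.1 lam.2).trans (Finset.card_eq_zero.1 mu.2).symm))
  rw [mul_apply, h, one_apply_eq]
  simp only [edge, transpose_apply, of_apply]
  exact_mod_cast sum_kappa_mul_kappa_zero mu mu

theorem edge_mul_transpose_succ (n : ℕ) :
    edge (n + 1) * (edge (n + 1))ᵀ = (edge n)ᵀ * edge n + 1 := by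
  ext lam mu
  rw [Matrix.add_apply, mul_apply, mul_apply, one_apply]
  simp only [edge, transpose_apply, of_apply]
  exact_mod_cast sum_kappa_mul_kappa lam mu

theorem dimVec_vecMul_edge (n : ℕ) : dimVec n ᵥ* edge n = dimVec (n + 1) := by
  ext Lam
  simp [vecMul, dotProduct, dimVec, edge, dim, mul_comm]

/-- Since `dim` on level `n + 2` is `U` of `dim` on level `n + 1`, the relation `DU = UD + 1` raises
the eigenvalue by one at each level. -/
theorem edge_mulVec_dimVec (n : ℕ) :
    edge n *ᵥ dimVec (n + 1) = ((n : ℝ) + 1) • dimVec n := by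
  induction n with
  | zero =>
    rw [← dimVec_vecMul_edge, ← mulVec_transpose, mulVec_mulVec, edge_mul_transpose_zero]
    simp
  | succ n ih =>
    rw [← dimVec_vecMul_edge, ← mulVec_transpose, mulVec_mulVec, edge_mul_transpose_succ,
      add_mulVec, one_mulVec, ← mulVec_mulVec, ih, mulVec_smul, mulVec_transpose,
      dimVec_vecMul_edge]
    push_cast
    module

theorem dimVec_dotProduct_self (n : ℕ) : dimVec n ⬝ᵥ dimVec n = (n.factorial : ℝ) := by
  induction n with
  | zero =>
    have : Unique (Level 0) :=
      { default := oneRow 0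
        uniq := fun lam => Subtype.ext (YoungDiagram.ext
          ((Finset.card_eq_zero.1 lam.2).trans (Finset.card_eq_zero.1 (oneRow 0).2).symm)) }
    simp [dotProduct, dimVec, dim]
  | succ n ih =>
    conv_lhs => enter [1]; rw [← dimVec_vecMul_edge]
    rw [← dotProduct_mulVec, edge_mulVec_dimVec, dotProduct_smul, ih, Nat.factorial_succ]
    push_cast
    rfl

/-! ### Norm bounds orthogonally to the dimension vector -/

theorem dotProduct_sq_le {ι : Type*} [Fintype ι] (f g : ι → ℝ) :
    (f ⬝ᵥ g) ^ 2 ≤ (f ⬝ᵥ f) * (g ⬝ᵥ g) := by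
  simpa only [dotProduct, ← sq] using Finset.sum_mul_sq_le_sq_mul_sq Finset.univ f g

theorem dotProduct_self_nonneg_real {ι : Type*} [Fintype ι] (f : ι → ℝ) : 0 ≤ f ⬝ᵥ f :=
  Finset.sum_nonneg fun i _ => mul_self_nonneg (f i)

theorem edge_mulVec_dotProduct_dimVec {n : ℕ} (g : Level (n + 1) → ℝ) :
    (edge n *ᵥ g) ⬝ᵥ dimVec n = g ⬝ᵥ dimVec (n + 1) := by
  rw [dotProduct_comm, dotProduct_mulVec, dimVec_vecMul_edge, dotProduct_comm]

theorem vecMul_edge_dotProduct_dimVec {n : ℕ} (w : Level n → ℝ) :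
    (w ᵥ* edge n) ⬝ᵥ dimVec (n + 1) = ((n : ℝ) + 1) * (w ⬝ᵥ dimVec n) := by
  rw [← dotProduct_mulVec, edge_mulVec_dimVec, dotProduct_smul, smul_eq_mul]

theorem vecMul_edge_dotProduct_self {n : ℕ} (w : Level (n + 1) → ℝ) :
    (w ᵥ* edge (n + 1)) ⬝ᵥ (w ᵥ* edge (n + 1)) =
      w ⬝ᵥ w + (edge n *ᵥ w) ⬝ᵥ (edge n *ᵥ w) := by
  rw [← dotProduct_mulVec, ← mulVec_transpose, mulVec_mulVec, edge_mul_transpose_succ,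
    add_mulVec, one_mulVec, dotProduct_add, add_comm, ← mulVec_mulVec, dotProduct_mulVec w,
    vecMul_transpose]

/-- A bound on the up operator passes to its adjoint, the down operator. -/
theorem edge_mulVec_le_of_vecMul_edge_le {n : ℕ} {a : ℝ} (g : Level (n + 1) → ℝ)
    (h : ((edge n *ᵥ g) ᵥ* edge n) ⬝ᵥ ((edge n *ᵥ g) ᵥ* edge n) ≤
      a * ((edge n *ᵥ g) ⬝ᵥ (edge n *ᵥ g)))
    (h0 : (edge n *ᵥ g) ⬝ᵥ (edge n *ᵥ g) = 0 → 0 ≤ a * (g ⬝ᵥ g)) :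
    (edge n *ᵥ g) ⬝ᵥ (edge n *ᵥ g) ≤ a * (g ⬝ᵥ g) := by
  set w := edge n *ᵥ g with hw
  -- Adjointness gives `‖w‖² = ⟨Uw, g⟩`, so Cauchy–Schwarz yields `‖w‖⁴ ≤ a ‖w‖² ‖g‖²`. Cancelling
  -- `‖w‖²` needs `w ≠ 0`.
  rcases (dotProduct_self_nonneg_real w).eq_or_lt with h1 | h1
  · rw [← h1]
    exact h0 h1.symm
  · have h2 : w ⬝ᵥ w = (w ᵥ* edge n) ⬝ᵥ g := by
      conv_lhs => enter [2]; rw [hw]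
      rw [dotProduct_mulVec]
    have h3 := dotProduct_sq_le (w ᵥ* edge n) g
    rw [← h2] at h3
    have h4 := mul_le_mul_of_nonneg_right h (dotProduct_self_nonneg_real g)
    refine le_of_mul_le_mul_left ?_ h1
    linarith

/-- On all densities the constant would be at least `n + 1`, attained at `dim`. Orthogonality to
`dim` is preserved by `D`, and each level adds 1 to the constant. At level 1 only `g = 0` qualifies,
which is why the value `-1` there is harmless. -/
theorem edge_mulVec_le {n : ℕ} (g : Level (n + 1) → ℝ) (hg : g ⬝ᵥ dimVec (n + 1) = 0) :
    (edge n *ᵥ g) ⬝ᵥ (edge n *ᵥ g) ≤ ((n : ℝ) - 1) * (g ⬝ᵥ g) := by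
  induction n with
  | zero =>
    have : g = 0 := by
      ext x
      rw [dotProduct, Fintype.sum_subsingleton _ x] at hg
      exact (mul_eq_zero.1 hg).resolve_right (dimVec_ne_zero x)
    simp [this]
  | succ n ih =>
    have h := ih (edge (n + 1) *ᵥ g) (by rw [edge_mulVec_dotProduct_dimVec, hg])
    refine edge_mulVec_le_of_vecMul_edge_le g ?_ fun _ => ?_
    · rw [vecMul_edge_dotProduct_self]
      push_cast
      linarith
    · push_cast
      have := dotProduct_self_nonneg_real g
      have : (0 : ℝ) ≤ n := n.cast_nonneg
      rw [add_sub_cancel_right]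
      positivity

theorem vecMul_edge_le {n : ℕ} (w : Level (n + 1) → ℝ) (hw : w ⬝ᵥ dimVec (n + 1) = 0) :
    (w ᵥ* edge (n + 1)) ⬝ᵥ (w ᵥ* edge (n + 1)) ≤ (n : ℝ) * (w ⬝ᵥ w) := by
  rw [vecMul_edge_dotProduct_self]
  linarith [edge_mulVec_le w hw]

/-! ### Contraction under the steps of the chain -/

/-- The density of `p` with respect to the dimension function. -/
noncomputable def dens {n : ℕ} (p : Level n → ℝ) : Level n → ℝ := fun x => p x / dimVec n x

theorem dens_dotProduct_dimVec {n : ℕ} (p : Level n → ℝ) :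
    dens p ⬝ᵥ dimVec n = ∑ x, p x :=
  Finset.sum_congr rfl fun x _ => div_mul_cancel₀ _ (dimVec_ne_zero x)

theorem dens_vecMul_down {n : ℕ} (p : Level (n + 1) → ℝ) :
    dens (p ᵥ* down (n + 1) n) = edge n *ᵥ dens p := by
  ext mu
  have := dimVec_ne_zero mu
  simp only [dens, vecMul, mulVec, dotProduct, down, edge, of_apply]
  rw [Finset.sum_div]
  refine Finset.sum_congr rfl fun Lam _ => ?_
  have := dimVec_ne_zero Lam
  simp only [dimVec] at *
  field_simp

theorem dens_vecMul_up {n : ℕ} (p : Level n → ℝ) :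
    dens (p ᵥ* up n (n + 1)) = ((n : ℝ) + 1)⁻¹ • (dens p ᵥ* edge n) := by
  ext Lam
  have := dimVec_ne_zero Lam
  simp only [dens, vecMul, dotProduct, up, edge, of_apply, plancherel, Pi.smul_apply,
    smul_eq_mul]
  rw [Finset.sum_div, Finset.mul_sum]
  refine Finset.sum_congr rfl fun lam _ => ?_
  have := dimVec_ne_zero lam
  have := n.factorial_ne_zero
  simp only [dimVec, Nat.factorial_succ] at *
  push_cast
  have : (n : ℝ) + 1 ≠ 0 := by positivity
  field_simp

/-- The squared norm, in which the moves of the chain contract, of a signed measure. -/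
noncomputable def densNormSq {n : ℕ} (p : Level n → ℝ) : ℝ := dens p ⬝ᵥ dens p

theorem sum_vecMul_down {n : ℕ} (p : Level (n + 1) → ℝ) :
    ∑ x, (p ᵥ* down (n + 1) n) x = ∑ x, p x := by
  rw [← dens_dotProduct_dimVec, dens_vecMul_down, edge_mulVec_dotProduct_dimVec,
    dens_dotProduct_dimVec]

theorem sum_vecMul_up {n : ℕ} (p : Level n → ℝ) :
    ∑ x, (p ᵥ* up n (n + 1)) x = ∑ x, p x := by
  rw [← dens_dotProduct_dimVec, dens_vecMul_up, smul_dotProduct, vecMul_edge_dotProduct_dimVec,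
    dens_dotProduct_dimVec, smul_eq_mul, inv_mul_cancel_left₀ (by positivity)]

theorem densNormSq_vecMul_down_le {n : ℕ} (p : Level (n + 1) → ℝ) (hp : ∑ x, p x = 0) :
    densNormSq (p ᵥ* down (n + 1) n) ≤ ((n : ℝ) - 1) * densNormSq p := by
  rw [densNormSq, dens_vecMul_down]
  exact edge_mulVec_le _ (by rw [dens_dotProduct_dimVec, hp])

theorem densNormSq_vecMul_up_le {n : ℕ} (p : Level (n + 1) → ℝ) (hp : ∑ x, p x = 0) :
    densNormSq (p ᵥ* up (n + 1) (n + 2)) ≤ (n : ℝ) / ((n : ℝ) + 2) ^ 2 * densNormSq p := by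
  rw [densNormSq, dens_vecMul_up, smul_dotProduct, dotProduct_smul, smul_eq_mul, smul_eq_mul]
  have h := vecMul_edge_le (dens p) (by rw [dens_dotProduct_dimVec, hp])
  push_cast
  calc _ = ((n : ℝ) + 2)⁻¹ ^ 2 * ((dens p ᵥ* edge (n + 1)) ⬝ᵥ (dens p ᵥ* edge (n + 1))) := by
        ring
    _ ≤ ((n : ℝ) + 2)⁻¹ ^ 2 * (n * (dens p ⬝ᵥ dens p)) := by gcongr
    _ = _ := by rw [densNormSq, div_eq_mul_inv, ← inv_pow]; ring

theorem sum_vecMul_downSteps {n k : ℕ} (hk : k ≤ n) (p : Level n → ℝ) :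
    ∑ x, (p ᵥ* downSteps n k) x = ∑ x, p x := by
  induction k with
  | zero => exact congrArg (fun q : Level n → ℝ => ∑ x, q x) (vecMul_one p)
  | succ k ih =>
    rw [downSteps, ← vecMul_vecMul, ← ih (by omega)]
    generalize p ᵥ* downSteps n k = q
    -- Truncated subtraction hides that `n - k` is a successor; with `m` as a variable the levels
    -- can be rewritten to `m + 1` and `m`.
    obtain ⟨m, hm⟩ : ∃ m, m = n - (k + 1) := ⟨_, rfl⟩
    have hm' : n - k = m + 1 := by omega
    revert q
    rw [← hm, hm']
    exact sum_vecMul_down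

theorem sum_vecMul_upSteps {n k : ℕ} (hk : k ≤ n) (p : Level (n - k) → ℝ) :
    ∑ x, (p ᵥ* upSteps n k) x = ∑ x, p x := by
  induction k with
  | zero => exact congrArg (fun q : Level n → ℝ => ∑ x, q x) (vecMul_one p)
  | succ k ih =>
    rw [upSteps, ← vecMul_vecMul, ih (by omega)]
    obtain ⟨m, hm⟩ : ∃ m, m = n - (k + 1) := ⟨_, rfl⟩
    have hm' : n - k = m + 1 := by omega
    revert p
    rw [← hm, hm']
    exact sum_vecMul_up

theorem densNormSq_vecMul_downSteps_le {n k : ℕ} (hk : k < n) (p : Level n → ℝ)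
    (hp : ∑ x, p x = 0) :
    densNormSq (p ᵥ* downSteps n k) ≤
      (∏ i ∈ Finset.range k, ((n : ℝ) - i - 2)) * densNormSq p := by
  induction k with
  | zero =>
    rw [Finset.prod_range_zero, one_mul]
    exact (congrArg (densNormSq (n := n)) (vecMul_one p)).le
  | succ k ih =>
    rw [downSteps, ← vecMul_vecMul, Finset.prod_range_succ]
    have h0 : ∑ x, (p ᵥ* downSteps n k) x = 0 := by rw [sum_vecMul_downSteps (by omega), hp]
    specialize ih (by omega)
    generalize p ᵥ* downSteps n k = q at *
    -- As `k + 1 < n`, the step leaves a level of the form `m + 2`, so its factor `n - k - 2` is the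
    -- natural number `m` and in particular nonnegative.
    obtain ⟨m, hm⟩ : ∃ m, m = n - (k + 1 + 1) := ⟨_, rfl⟩
    have hm1 : n - (k + 1) = m + 1 := by omega
    have hm' : n - k = m + 2 := by omega
    have hc : (n : ℝ) - k - 2 = m := by
      rw [show n = m + 2 + k by omega]; push_cast; ring
    rw [hc]
    revert q
    rw [hm1, hm']
    intro q ih h0
    have h1 := densNormSq_vecMul_down_le q h0
    push_cast at h1
    rw [add_sub_cancel_right] at h1
    have := mul_le_mul_of_nonneg_left ih (m.cast_nonneg (α := ℝ))
    linarith

theorem densNormSq_vecMul_upSteps_le {n k : ℕ} (hk : k < n) (p : Level (n - k) → ℝ)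
    (hp : ∑ x, p x = 0) :
    densNormSq (p ᵥ* upSteps n k) ≤
      (∏ i ∈ Finset.range k, ((n : ℝ) - i - 2) / ((n : ℝ) - i) ^ 2) * densNormSq p := by
  induction k with
  | zero =>
    rw [Finset.prod_range_zero, one_mul]
    exact (congrArg (densNormSq (n := n)) (vecMul_one p)).le
  | succ k ih =>
    rw [upSteps, ← vecMul_vecMul, Finset.prod_range_succ, mul_assoc]
    have hprod : 0 ≤ ∏ i ∈ Finset.range k, ((n : ℝ) - i - 2) / ((n : ℝ) - i) ^ 2 := by
      refine Finset.prod_nonneg fun i hi => div_nonneg ?_ (sq_nonneg _)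
      have := Finset.mem_range.1 hi
      have : ((i + 2 : ℕ) : ℝ) ≤ n := Nat.cast_le.2 (by omega)
      push_cast at this
      linarith
    obtain ⟨m, hm⟩ : ∃ m, m = n - (k + 1 + 1) := ⟨_, rfl⟩
    have hm1 : n - (k + 1) = m + 1 := by omega
    have hm' : n - k = m + 2 := by omega
    have hc : (n : ℝ) = m + 2 + k := by
      rw [show n = m + 2 + k by omega]; push_cast; ring
    have hstep : ∑ x, (p ᵥ* up (n - (k + 1)) (n - k)) x = 0 ∧
        densNormSq (p ᵥ* up (n - (k + 1)) (n - k)) ≤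
          (m : ℝ) / ((m : ℝ) + 2) ^ 2 * densNormSq p := by
      clear ih
      revert p
      rw [hm1, hm']
      exact fun p hp => ⟨(sum_vecMul_up p).trans hp, densNormSq_vecMul_up_le p hp⟩
    refine (ih (by omega) _ hstep.1).trans (mul_le_mul_of_nonneg_left ?_ hprod)
    refine hstep.2.trans_eq ?_
    congr 2
    · rw [hc]; ring
    · rw [hc]; ring

/-- The product telescopes with gap two: the numerator at `i` is the denominator at `i + 2`. -/
theorem prod_ratio {n k : ℕ} (hn : 2 ≤ n) (hk : k < n) :
    ∏ i ∈ Finset.range k, (((n : ℝ) - i - 2) / ((n : ℝ) - i)) =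
      (((n : ℝ) - k) * ((n : ℝ) - k - 1)) / ((n : ℝ) * ((n : ℝ) - 1)) := by
  induction k with
  | zero =>
    have h1 : ((2 : ℕ) : ℝ) ≤ n := Nat.cast_le.2 hn
    push_cast at h1
    have : (n : ℝ) ≠ 0 := by linarith
    have : (n : ℝ) - 1 ≠ 0 := by linarith
    simp only [Finset.prod_range_zero, Nat.cast_zero, sub_zero]
    field_simp
  | succ k ih =>
    rw [Finset.prod_range_succ, ih (by omega)]
    have h1 : ((k + 2 : ℕ) : ℝ) ≤ n := Nat.cast_le.2 (by omega)
    push_cast at h1 ⊢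
    have hk0 : (0 : ℝ) ≤ k := k.cast_nonneg
    have : (n : ℝ) ≠ 0 := by linarith
    have : (n : ℝ) - 1 ≠ 0 := by linarith
    have : (n : ℝ) - k ≠ 0 := by linarith
    field_simp
    ring

theorem sum_vecMul_J {n k : ℕ} (hk : k ≤ n) (p : Level n → ℝ) :
    ∑ x, (p ᵥ* J n k) x = ∑ x, p x := by
  rw [J, ← vecMul_vecMul, sum_vecMul_upSteps hk, sum_vecMul_downSteps hk]

theorem densNormSq_vecMul_J_le {n k : ℕ} (hn : 2 ≤ n) (hk : k < n) (p : Level n → ℝ)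
    (hp : ∑ x, p x = 0) :
    densNormSq (p ᵥ* J n k) ≤
      ((((n : ℝ) - k) * ((n : ℝ) - k - 1)) / ((n : ℝ) * ((n : ℝ) - 1))) ^ 2 *
        densNormSq p := by
  rw [J, ← vecMul_vecMul]
  have hprod : 0 ≤ ∏ i ∈ Finset.range k, ((n : ℝ) - i - 2) / ((n : ℝ) - i) ^ 2 := by
    refine Finset.prod_nonneg fun i hi => div_nonneg ?_ (sq_nonneg _)
    have := Finset.mem_range.1 hi
    have : ((i + 2 : ℕ) : ℝ) ≤ n := Nat.cast_le.2 (by omega)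
    push_cast at this
    linarith
  refine (densNormSq_vecMul_upSteps_le hk _ (by rw [sum_vecMul_downSteps hk.le, hp])).trans ?_
  refine (mul_le_mul_of_nonneg_left (densNormSq_vecMul_downSteps_le hk p hp) hprod).trans_eq ?_
  -- Each level passed going down and again going up contributes the square of `(n - i - 2) / (n -
  -- i)`.
  rw [← prod_ratio hn hk, ← mul_assoc, ← Finset.prod_mul_distrib, ← Finset.prod_pow]
  congr 1
  refine Finset.prod_congr rfl fun i _ => ?_
  rw [div_pow]
  ring

/-! ### Stationarity and the initial deviation -/

theorem dens_injective {n : ℕ} : Function.Injective (dens (n := n)) := fun p q h => by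
  ext x
  exact (div_left_inj' (dimVec_ne_zero x)).1 (congrFun h x)

theorem dens_plancherel (n : ℕ) :
    dens (plancherel n) = (n.factorial : ℝ)⁻¹ • dimVec n := by
  ext x
  have := dimVec_ne_zero x
  have := n.factorial_ne_zero
  simp only [dens, plancherel, Pi.smul_apply, smul_eq_mul, dimVec] at *
  field_simp

theorem plancherel_vecMul_down (n : ℕ) :
    plancherel (n + 1) ᵥ* down (n + 1) n = plancherel n := by
  apply dens_injective
  rw [dens_vecMul_down, dens_plancherel, dens_plancherel, mulVec_smul, edge_mulVec_dimVec,
    smul_smul, Nat.factorial_succ]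
  congr 1
  push_cast
  have := n.factorial_ne_zero
  have : (n : ℝ) + 1 ≠ 0 := by positivity
  field_simp

theorem plancherel_vecMul_up (n : ℕ) :
    plancherel n ᵥ* up n (n + 1) = plancherel (n + 1) := by
  apply dens_injective
  rw [dens_vecMul_up, dens_plancherel, dens_plancherel, smul_vecMul, dimVec_vecMul_edge,
    smul_smul, Nat.factorial_succ]
  congr 1
  push_cast
  rw [mul_inv]

theorem plancherel_vecMul_downSteps {n k : ℕ} (hk : k ≤ n) :
    plancherel n ᵥ* downSteps n k = plancherel (n - k) := by
  induction k with
  | zero => exact vecMul_one _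
  | succ k ih =>
    rw [downSteps, ← vecMul_vecMul, ih (by omega)]
    obtain ⟨m, hm⟩ : ∃ m, m = n - (k + 1) := ⟨_, rfl⟩
    have hm' : n - k = m + 1 := by omega
    rw [← hm, hm']
    exact plancherel_vecMul_down m

theorem plancherel_vecMul_upSteps {n k : ℕ} (hk : k ≤ n) :
    plancherel (n - k) ᵥ* upSteps n k = plancherel n := by
  induction k with
  | zero => exact vecMul_one _
  | succ k ih =>
    rw [upSteps, ← vecMul_vecMul]
    refine Eq.trans ?_ (ih (by omega))
    congr 1
    obtain ⟨m, hm⟩ : ∃ m, m = n - (k + 1) := ⟨_, rfl⟩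
    have hm' : n - k = m + 1 := by omega
    rw [← hm, hm']
    exact plancherel_vecMul_up m

/-- The Plancherel measure is stationary. -/
theorem plancherel_vecMul_J {n k : ℕ} (hk : k ≤ n) :
    plancherel n ᵥ* J n k = plancherel n := by
  rw [J, ← vecMul_vecMul, plancherel_vecMul_downSteps hk, plancherel_vecMul_upSteps hk]

theorem sum_plancherel (n : ℕ) : ∑ x, plancherel n x = 1 := by
  rw [← dens_dotProduct_dimVec, dens_plancherel, smul_dotProduct, dimVec_dotProduct_self,
    smul_eq_mul, inv_mul_cancel₀ (by positivity)]

theorem plancherel_pos {n : ℕ} (x : Level n) : 0 < plancherel n x :=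
  div_pos (pow_pos (dimVec_pos x) 2) (by positivity)

theorem sum_sub_plancherel {n : ℕ} (x : Level n) :
    ∑ y, (Pi.single x 1 - plancherel n : Level n → ℝ) y = 0 := by
  simp [sum_plancherel]

/-- The squared norm is exactly `1 / dim(x)² - 1 / n!`. Hence the bounds below hold from every
starting diagram, not only from `(n)`. -/
theorem densNormSq_single_sub_plancherel_le {n : ℕ} (x : Level n) :
    densNormSq (Pi.single x 1 - plancherel n : Level n → ℝ) ≤ 1 := by
  have hd : dens (Pi.single x 1 - plancherel n : Level n → ℝ) =
      Pi.single x (dimVec n x)⁻¹ - (n.factorial : ℝ)⁻¹ • dimVec n := by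
    rw [← dens_plancherel]
    ext y
    by_cases h : y = x
    · subst h
      simp [dens, sub_div]
    · simp [dens, h, neg_div]
  have hf : (0 : ℝ) < (n.factorial : ℝ) := by positivity
  have h1 : (1 : ℝ) ≤ dimVec n x := Nat.one_le_cast.2 (dim_pos n x)
  have h2 : (dimVec n x)⁻¹ ≤ 1 := inv_le_one_of_one_le₀ h1
  have h3 : 0 ≤ (dimVec n x)⁻¹ := by positivity
  rw [densNormSq, hd, sub_dotProduct, dotProduct_sub, dotProduct_sub, single_dotProduct,
    single_dotProduct, dotProduct_single, smul_dotProduct, dotProduct_smul,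
    dimVec_dotProduct_self]
  simp only [Pi.single_eq_same, Pi.smul_apply, smul_eq_mul]
  have h4 : (dimVec n x)⁻¹ * ((n.factorial : ℝ)⁻¹ * dimVec n x) = (n.factorial : ℝ)⁻¹ := by
    have := dimVec_ne_zero x
    field_simp
  rw [h4, mul_assoc _ (dimVec n x), mul_comm (dimVec n x), ← mul_assoc,
    mul_comm (n.factorial : ℝ)⁻¹ (dimVec n x)⁻¹, mul_assoc, h4, inv_mul_cancel₀ hf.ne']
  have : 0 < (n.factorial : ℝ)⁻¹ := by positivity
  nlinarith

theorem row_pow_sub_plancherel {n k : ℕ} (hk : k ≤ n) (x : Level n) (r : ℕ) :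
    (J n k ^ r) x - plancherel n =
      (Pi.single x 1 - plancherel n : Level n → ℝ) ᵥ* J n k ^ r := by
  have h : plancherel n ᵥ* J n k ^ r = plancherel n := by
    induction r with
    | zero => rw [pow_zero, vecMul_one]
    | succ r ih => rw [pow_succ, ← vecMul_vecMul, ih, plancherel_vecMul_J hk]
  rw [sub_vecMul, h, single_one_vecMul]
  rfl

theorem sum_vecMul_J_pow {n k : ℕ} (hk : k ≤ n) (r : ℕ) (p : Level n → ℝ) :
    ∑ x, (p ᵥ* J n k ^ r) x = ∑ x, p x := by
  induction r with
  | zero => rw [pow_zero, vecMul_one]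
  | succ r ih => rw [pow_succ, ← vecMul_vecMul, sum_vecMul_J hk, ih]

theorem densNormSq_vecMul_J_pow_le {n k : ℕ} (hn : 2 ≤ n) (hk : k < n) (r : ℕ)
    (p : Level n → ℝ) (hp : ∑ x, p x = 0) :
    densNormSq (p ᵥ* J n k ^ r) ≤
      (((((n : ℝ) - k) * ((n : ℝ) - k - 1)) / ((n : ℝ) * ((n : ℝ) - 1))) ^ r) ^ 2 *
        densNormSq p := by
  induction r with
  | zero => simp
  | succ r ih =>
    rw [pow_succ (J n k), ← vecMul_vecMul]
    refine (densNormSq_vecMul_J_le hn hk _ (by rw [sum_vecMul_J_pow hk.le, hp])).trans ?_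
    refine (mul_le_mul_of_nonneg_left ih (sq_nonneg _)).trans_eq ?_
    ring

/-! ### From the norm to total variation -/

theorem ell2Norm_eq_sqrt {n : ℕ} (p : Level n → ℝ) :
    ell2Norm (plancherel n) (fun x => p x / plancherel n x - 1) =
      √(n.factorial * densNormSq (p - plancherel n)) := by
  rw [ell2Norm, ← Real.sqrt_eq_rpow]
  congr 1
  rw [densNormSq, dotProduct, Finset.mul_sum]
  refine Finset.sum_congr rfl fun x _ => ?_
  have := dimVec_ne_zero x
  have := n.factorial_ne_zero
  simp only [sq_abs, dens, Pi.sub_apply, plancherel, dimVec] at *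
  field_simp

/-- Cauchy–Schwarz, with `|p - q|²` split as `(p / q - 1)² q` times `q`, and `q` of mass 1. -/
theorem two_mul_tvDist_le_ell2Norm {X : Type*} [Fintype X] (p q : X → ℝ) (hq : ∀ x, 0 < q x)
    (hq1 : ∑ x, q x = 1) :
    2 * tvDist p q ≤ ell2Norm q (fun x => p x / q x - 1) := by
  rw [ell2Norm, ← Real.sqrt_eq_rpow, tvDist, ← mul_assoc]
  norm_num
  apply Real.le_sqrt_of_sq_le
  have h := Finset.sum_sq_le_sum_mul_sum_of_sq_le_mul Finset.univ (r := fun x => |p x - q x|)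
    (f := fun x => (p x / q x - 1) ^ 2 * q x) (g := q)
    (fun x _ => by have := hq x; positivity) (fun x _ => (hq x).le) (fun x _ => by
      have := (hq x).ne'
      rw [sq_abs]
      apply le_of_eq
      field_simp)
  rwa [hq1, mul_one] at h

theorem ell2Norm_le {n k : ℕ} (hn : 2 ≤ n) (hk : k < n) (x : Level n) (r : ℕ) :
    ell2Norm (plancherel n) (fun y => (J n k ^ r) x y / plancherel n y - 1) ≤
      √(n.factorial : ℝ) *
        ((((n : ℝ) - k) * ((n : ℝ) - k - 1)) / ((n : ℝ) * ((n : ℝ) - 1))) ^ r := by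
  set β := (((n : ℝ) - k) * ((n : ℝ) - k - 1)) / ((n : ℝ) * ((n : ℝ) - 1)) with hβ
  have h0 : 0 ≤ β := by
    have h1 : ((k + 1 : ℕ) : ℝ) ≤ n := Nat.cast_le.2 hk
    have h2 : ((2 : ℕ) : ℝ) ≤ n := Nat.cast_le.2 hn
    push_cast at h1 h2
    exact div_nonneg (mul_nonneg (by linarith) (by linarith))
      (mul_nonneg (by linarith) (by linarith))
  rw [ell2Norm_eq_sqrt, row_pow_sub_plancherel hk.le, Real.sqrt_mul (by positivity)]
  refine mul_le_mul_of_nonneg_left ?_ (Real.sqrt_nonneg _)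
  rw [Real.sqrt_le_left (pow_nonneg h0 r)]
  refine (densNormSq_vecMul_J_pow_le hn hk r _ (sum_sub_plancherel x)).trans ?_
  exact mul_le_of_le_one_right (sq_nonneg _) (densNormSq_single_sub_plancherel_le x)

/-- The crude bound `n! ≤ n ^ n` cancels the term `n log n` in the condition on `r` and already
gives `e^{-c}`; the factor `(2π)^{1/4}` is at least 1 and only weakens this. -/
theorem sqrt_factorial_mul_pow_le {n : ℕ} (hn : 1 ≤ n) {β c : ℝ} (h0 : 0 ≤ β) (h1 : β < 1)
    {r : ℕ} (hr : (r : ℝ) > (n * Real.log n + 2 * c) / (2 * Real.log (1 / β))) :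
    √(n.factorial : ℝ) * β ^ r ≤ (2 * Real.pi) ^ (1 / 4 : ℝ) * Real.exp (-c) := by
  have hpi : 1 ≤ (2 * Real.pi) ^ (1 / 4 : ℝ) :=
    Real.one_le_rpow (by linarith [Real.pi_gt_three]) (by norm_num)
  refine le_trans ?_ (le_mul_of_one_le_left (Real.exp_pos _).le hpi)
  rcases h0.eq_or_lt with rfl | h0
  -- For `β = 0` both `1 / β` and its `Real.log` take the default value 0, and so does the quotient
  -- in `hr`, which then reads `r > 0`.
  · have : r ≠ 0 := by
      rintro rfl
      simp at hr
    simp [this, (Real.exp_pos _).le]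
  · have hlog : 0 < Real.log (1 / β) := Real.log_pos (one_lt_one_div h0 h1)
    rw [gt_iff_lt, div_lt_iff₀ (by positivity), one_div, Real.log_inv] at hr
    have hn0 : (0 : ℝ) < n := by exact_mod_cast hn
    have hf : √(n.factorial : ℝ) ≤ Real.exp (n * Real.log n / 2) := by
      apply Real.sqrt_le_iff.2 ⟨(Real.exp_pos _).le, ?_⟩
      rw [← Real.exp_nat_mul]
      push_cast
      rw [mul_div_cancel₀ _ two_ne_zero, ← Real.log_pow, Real.exp_log (by positivity)]
      exact_mod_cast n.factorial_le_pow
    have hb : β ^ r = Real.exp (r * Real.log β) := by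
      rw [Real.exp_nat_mul, Real.exp_log h0]
    rw [hb]
    calc _ ≤ Real.exp (n * Real.log n / 2) * Real.exp (r * Real.log β) := by gcongr
      _ = Real.exp (n * Real.log n / 2 + r * Real.log β) := (Real.exp_add _ _).symm
      _ ≤ _ := Real.exp_le_exp.2 (by linarith)

end YoungChain

/-- Here `J n k ^ r` is the `r`-step transition matrix of `J(k)`. When `k = n - 1` one has `β = 0`,
and the condition on `r` in the second part then reads `0 < r`, that is, `log (1 / β) = ∞`. -/
theorem mainTheorem9 (n k : ℕ) (hn : 3 ≤ n) (hk : 1 ≤ k) (hkn : k < n)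
    (β : ℝ) (hβ : β = (((n : ℝ) - k) * ((n : ℝ) - k - 1)) / ((n : ℝ) * ((n : ℝ) - 1))) :
    (∀ r : ℕ,
      2 * YoungChain.tvDist ((YoungChain.J n k ^ r) (YoungChain.oneRow n))
          (YoungChain.plancherel n)
        ≤ YoungChain.ell2Norm (YoungChain.plancherel n)
          (fun lam => (YoungChain.J n k ^ r) (YoungChain.oneRow n) lam
            / YoungChain.plancherel n lam - 1) ∧
      YoungChain.ell2Norm (YoungChain.plancherel n)
          (fun lam => (YoungChain.J n k ^ r) (YoungChain.oneRow n) lam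
            / YoungChain.plancherel n lam - 1)
        ≤ Real.sqrt (n.factorial : ℝ) * β ^ r) ∧
    (∀ (c : ℝ) (r : ℕ),
      (r : ℝ) > ((n : ℝ) * Real.log n + 2 * c) / (2 * Real.log (1 / β)) →
      YoungChain.tvDist ((YoungChain.J n k ^ r) (YoungChain.oneRow n)) (YoungChain.plancherel n)
        ≤ (2 * Real.pi) ^ (1 / 4 : ℝ) / 2 * Real.exp (-c)) := by
  have h0 : 0 ≤ β := by
    have h1 : ((k + 1 : ℕ) : ℝ) ≤ n := Nat.cast_le.2 hkn
    have h2 : ((3 : ℕ) : ℝ) ≤ n := Nat.cast_le.2 hn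
    push_cast at h1 h2
    rw [hβ]
    exact div_nonneg (mul_nonneg (by linarith) (by linarith))
      (mul_nonneg (by linarith) (by linarith))
  have h1 : β < 1 := by
    have h1 : ((k + 1 : ℕ) : ℝ) ≤ n := Nat.cast_le.2 hkn
    have h2 : ((3 : ℕ) : ℝ) ≤ n := Nat.cast_le.2 hn
    have h3 : ((1 : ℕ) : ℝ) ≤ k := Nat.cast_le.2 hk
    push_cast at h1 h2 h3
    rw [hβ, div_lt_one (mul_pos (by linarith) (by linarith))]
    exact mul_lt_mul' (by linarith) (by linarith) (by linarith) (by linarith)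
  have hmain : ∀ r : ℕ, _ ∧ _ := fun r => And.intro
    (YoungChain.two_mul_tvDist_le_ell2Norm ((YoungChain.J n k ^ r) (YoungChain.oneRow n))
      (YoungChain.plancherel n) YoungChain.plancherel_pos (YoungChain.sum_plancherel n))
    (hβ ▸ YoungChain.ell2Norm_le (by omega) hkn (YoungChain.oneRow n) r)
  refine ⟨hmain, fun c r hr => ?_⟩
  have h2 := (hmain r).1.trans (hmain r).2
  have h3 := YoungChain.sqrt_factorial_mul_pow_le (by omega) h0 h1 hr
  linarith
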